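/- Let $N\ge 1$ and $k\ge 1$ be integers and let $\chi$ be a (not necessarily primitive) Dirichlet character modulo $N$ with $\chi(-1)=(-1)^k$; let $m_\chi$ be its conductor and $\varphi$ Euler's totient function. Define $\beta_{k,N,a}$ and the generalized Bernoulli numbers $B_{k,\chi}$ by $$\frac{x e^{ax}}{e^{Nx}-1}=\sum_{k\ge 0}\beta_{k,N,a}\frac{x^k}{k!},\qquad B_{k,\chi}=\sum_{a=1}^N\chi(a)\,\beta_{k,N,a},$$ let $B_k$ be the ordinary Bernoulli numbers, and for an integer $b\ge 0$ put $c_\chi(b)=\sum_{a=1}^N\chi(-a)e^{2\pi i ab/N}$. For $\tau$ in the upper half-plane and $q=e^{2\pi i\tau}$ let $$\widetilde E_{k,\chi}(\tau)=-\frac{B_{k,\chi}}{2k}+\sum_{m\ge 1}\sum_{n\mid m}\chi(n)n^{k-1}q^m,$$ $$\widehat E_{k,\chi}(\tau)=N^{\frac k2-1}\Bigl(-\frac{B_k}{2k}\,\varphi(N)\,\delta_{m_\chi,1}-\frac{\delta_{k,1}}{2}\sum_{b=1}^N c_\chi(b)\,\beta_{1,N,b}+\sum_{m\ge 1}\sum_{n\mid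 m}c_\chi(m/n)\,n^{k-1}q^m\Bigr).$$ Then for every $\tau$ in the upper half-plane $$\widetilde E_{k,\chi}\Bigl(-\frac1{N\tau}\Bigr)=(\sqrt N\,\tau)^k\,\widehat E_{k,\chi}(\tau)+\delta_{N,1}\delta_{k,2}\,\frac{iN}{4\pi}\,\tau .$$ -/

import Mathlib

open Complex Finset

namespace FrickeEisenstein

/-- The power series `(e^{Nx} - 1) / x = ∑ₙ N^{n+1} / (n+1)! xⁿ`. -/
noncomputable def expSubOneDivX (N : ℕ) : PowerSeries ℂ :=
  PowerSeries.mk fun n => (N : ℂ) ^ (n + 1) / ((n + 1).factorial : ℂ)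

/-- The power series `x e^{ax} / (e^{Nx} - 1)`, for `N ≥ 1`. -/
noncomputable def betaSeries (N a : ℕ) : PowerSeries ℂ :=
  PowerSeries.rescale (a : ℂ) (PowerSeries.exp ℂ) * (expSubOneDivX N)⁻¹

theorem X_mul_expSubOneDivX (N : ℕ) :
    PowerSeries.X * expSubOneDivX N
      = PowerSeries.rescale (N : ℂ) (PowerSeries.exp ℂ) - 1 := by
  ext n
  cases n with
  | zero =>
    rw [PowerSeries.coeff_zero_X_mul, map_sub, PowerSeries.coeff_rescale, PowerSeries.coeff_exp]
    simp
  | succ n =>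
    rw [PowerSeries.coeff_succ_X_mul]
    simp [expSubOneDivX, PowerSeries.coeff_rescale, PowerSeries.coeff_exp, PowerSeries.coeff_one,
      div_eq_mul_inv]

/-- `betaSeries N a` is the quotient of `x e^{ax}` by `e^{Nx} - 1`. -/
theorem betaSeries_mul (N a : ℕ) [NeZero N] :
    betaSeries N a * (PowerSeries.rescale (N : ℂ) (PowerSeries.exp ℂ) - 1)
      = PowerSeries.X * PowerSeries.rescale (a : ℂ) (PowerSeries.exp ℂ) := by
  have h0 : PowerSeries.constantCoeff (expSubOneDivX N) ≠ 0 := by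
    rw [← PowerSeries.coeff_zero_eq_constantCoeff_apply]
    simp [expSubOneDivX, NeZero.ne N]
  have h1 := PowerSeries.inv_mul_cancel _ h0
  rw [← X_mul_expSubOneDivX, betaSeries]
  calc _ = PowerSeries.X * PowerSeries.rescale (a : ℂ) (PowerSeries.exp ℂ)
        * ((expSubOneDivX N)⁻¹ * expSubOneDivX N) := by ring
    _ = _ := by rw [h1, mul_one]

/-- The numbers `β_{k,N,a}` with `x e^{ax} / (e^{Nx} - 1) = ∑ₖ β_{k,N,a} x^k / k!`. -/
noncomputable def beta (k N a : ℕ) : ℂ :=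
  (k.factorial : ℂ) * PowerSeries.coeff k (betaSeries N a)

/-- The generalized Bernoulli number `B_{k,χ}`, with
`∑_{a=1}^N χ(a) x e^{ax} / (e^{Nx} - 1) = ∑ₖ B_{k,χ} x^k / k!`; `χ` need not be primitive. -/
noncomputable def genBernoulli {N : ℕ} (k : ℕ) (χ : DirichletCharacter ℂ N) : ℂ :=
  ∑ a ∈ Icc 1 N, χ (a : ZMod N) * beta k N a

/-- The finite Fourier transform `∑_{a=1}^N χ(-a) e^{2πi a b / N}`. -/
noncomputable def charFourier {N : ℕ} (χ : DirichletCharacter ℂ N) (b : ℕ) : ℂ :=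
  ∑ a ∈ Icc 1 N, χ (-(a : ZMod N)) * cexp (2 * Real.pi * I * a * b / N)

/-- The coefficient of `q^m` in `Ẽ_{k,χ}`, for `m ≥ 1`. -/
noncomputable def tildeCoeff {N : ℕ} (k : ℕ) (χ : DirichletCharacter ℂ N) (m : ℕ) : ℂ :=
  ∑ n ∈ m.divisors, χ (n : ZMod N) * (n : ℂ) ^ (k - 1)

/-- The coefficient of `q^m` in `N^{1 - k/2} Ê_{k,χ}`, for `m ≥ 1`. -/
noncomputable def hatCoeff {N : ℕ} (k : ℕ) (χ : DirichletCharacter ℂ N) (m : ℕ) : ℂ :=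
  ∑ n ∈ m.divisors, charFourier χ (m / n) * (n : ℂ) ^ (k - 1)

/-- The Eisenstein series `Ẽ_{k,χ}(τ)`, where `q = e^{2πiτ}`. -/
noncomputable def eisTilde {N : ℕ} (k : ℕ) (χ : DirichletCharacter ℂ N) (τ : ℂ) : ℂ :=
  -genBernoulli k χ / (2 * k)
    + ∑' m : ℕ+, tildeCoeff k χ m * cexp (2 * Real.pi * I * τ) ^ (m : ℕ)

/-- The constant term of `N^{1 - k/2} Ê_{k,χ}`. The first summand is present only for principal
`χ` (conductor one), the second one only in weight one. -/
noncomputable def hatConst {N : ℕ} (k : ℕ) (χ : DirichletCharacter ℂ N) : ℂ :=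
  -((bernoulli k : ℚ) : ℂ) / (2 * k) * (if χ.conductor = 1 then (N.totient : ℂ) else 0)
    - (if k = 1 then (1 / 2 : ℂ) * ∑ b ∈ Icc 1 N, charFourier χ b * beta 1 N b else 0)

/-- The Eisenstein series `Ê_{k,χ}(τ)`, where `q = e^{2πiτ}`. -/
noncomputable def eisHat {N : ℕ} (k : ℕ) (χ : DirichletCharacter ℂ N) (τ : ℂ) : ℂ :=
  (((N : ℝ) ^ ((k : ℝ) / 2 - 1) : ℝ) : ℂ)
    * (hatConst k χ + ∑' m : ℕ+, hatCoeff k χ m * cexp (2 * Real.pi * I * τ) ^ (m : ℕ))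

theorem norm_charFourier_le {N : ℕ} (χ : DirichletCharacter ℂ N) (b : ℕ) :
    ‖charFourier χ b‖ ≤ N := by
  have h : ∀ a ∈ Icc 1 N,
      ‖χ (-(a : ZMod N)) * cexp (2 * Real.pi * I * a * b / N)‖ ≤ 1 := by
    intro a _
    have e : 2 * Real.pi * I * a * b / N = ((2 * Real.pi * a * b / N : ℝ) : ℂ) * I := by
      push_cast; ring
    rw [norm_mul, e, norm_exp_ofReal_mul_I, mul_one]
    exact χ.norm_le_one _
  refine (norm_sum_le_of_le _ h).trans ?_
  simp

theorem summable_aux (f : ℕ → ℕ → ℂ) (C : ℝ) (hf : ∀ m n, ‖f m n‖ ≤ C) (k : ℕ)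
    {τ : ℂ} (hτ : 0 < τ.im) :
    Summable fun m : ℕ+ =>
      (∑ n ∈ (m : ℕ).divisors, f m n * (n : ℂ) ^ k) * cexp (2 * Real.pi * I * τ) ^ (m : ℕ) := by
  have hq : ‖cexp (2 * Real.pi * I * τ)‖ < 1 := by
    rw [norm_exp, Real.exp_lt_one_iff]
    have : (2 * Real.pi * I * τ).re = -(2 * Real.pi * τ.im) := by simp
    rw [this]
    have := Real.pi_pos
    nlinarith [mul_pos this hτ]
  have hC : 0 ≤ C := (norm_nonneg _).trans (hf 0 0)
  have hs := (summable_pow_mul_geometric_of_norm_lt_one (R := ℝ) (k + 1)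
    (r := ‖cexp (2 * Real.pi * I * τ)‖) (by simpa using hq)).mul_left C
  have hs' := hs.comp_injective PNat.coe_injective
  refine Summable.of_norm_bounded hs' fun m => ?_
  simp only [Function.comp_apply]
  rw [norm_mul, norm_pow, ← mul_assoc]
  gcongr
  have hb : ∀ n ∈ (m : ℕ).divisors, ‖f m n * (n : ℂ) ^ k‖ ≤ C * (m : ℝ) ^ k := by
    intro n hn
    rw [norm_mul, norm_pow, norm_natCast]
    have : (n : ℝ) ≤ (m : ℕ) := by exact_mod_cast Nat.divisor_le hn
    gcongr
    exact hf _ _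
  refine (norm_sum_le_of_le _ hb).trans ?_
  rw [sum_const, nsmul_eq_mul, pow_succ]
  have h2 : (((m : ℕ).divisors.card : ℕ) : ℝ) ≤ (m : ℕ) := by
    exact_mod_cast Nat.card_divisors_le_self _
  have h3 : 0 ≤ C * ((m : ℕ) : ℝ) ^ k := by positivity
  nlinarith [mul_le_mul_of_nonneg_right h2 h3]

/-- The `q`-series of `Ẽ_{k,χ}` converges on the upper half-plane. -/
theorem summable_tilde {N : ℕ} (k : ℕ) (χ : DirichletCharacter ℂ N) {τ : ℂ} (hτ : 0 < τ.im) :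
    Summable fun m : ℕ+ => tildeCoeff k χ m * cexp (2 * Real.pi * I * τ) ^ (m : ℕ) :=
  summable_aux (fun _ n => χ (n : ZMod N)) 1 (fun _ _ => χ.norm_le_one _) (k - 1) hτ

/-- The `q`-series of `Ê_{k,χ}` converges on the upper half-plane. -/
theorem summable_hat {N : ℕ} (k : ℕ) (χ : DirichletCharacter ℂ N) {τ : ℂ} (hτ : 0 < τ.im) :
    Summable fun m : ℕ+ => hatCoeff k χ m * cexp (2 * Real.pi * I * τ) ^ (m : ℕ) :=
  summable_aux (fun m n => charFourier χ (m / n)) N (fun _ _ => norm_charFourier_le χ _) (k - 1) hτ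

end FrickeEisenstein

namespace FrickeEisenstein

open Filter Topology SummationFilter Asymptotics
open UpperHalfPlane hiding I

/-! Both sides are one lattice sum computed in two orders. Put `z = Nτ`, `x = b/N`, and consider `∑
(xz + mz + d)⁻ᵏ` over integers `m, d`. Summing over `d` first, the Lipschitz formula gives
exponential series in multiples of `τ`. Summing over `m` first, after extracting `z⁻ᵏ`, it gives
exponential series at `-1/z = -1/(Nτ)`, twisted by `e(nb/N)`. Weight the identity by `charFourier χ
b` and sum over `b` mod `N`: on the first side the residue classes reassemble into the series of
`Ê`; on the second, Fourier inversion turns the twists into `N χ(n)` and gives `Ẽ`. The parity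
`χ(-1) = (-1)ᵏ` makes the two halves of each sum agree.

For `k ≤ 2` the order of summation matters. Removing the terms of order `w⁻¹` and `w⁻²`
(`regSummand`) makes the double sum absolutely convergent. The `w⁻¹` terms cancel by oddness, and
the `w⁻²` terms sum to a multiple of `G2`, so the defect is governed by `z⁻² G2(-1/z) = G2(z) -
2πi/z` (`tsum_row_sub_tsum_col`). In weight one this defect produces the constant term of `Ê`; in
weight two, after summation over `b`, it survives only for `N = 1` and is the extra term linear in
`τ`.

The remaining constants are values of `symInvPow k (b/N)`. They come from the Fourier expansion of
the Bernoulli functions for `k ≥ 2` (`symInvPow_div`) and from the cotangent for `k = 1`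
(`symInvPow_one_div`). -/

/-! ### Absolute convergence of the regularised lattice sum -/

theorem isBigO_add_inv_cobounded (u : ℂ) :
    (fun w : ℂ => (u + w)⁻¹) =O[Bornology.cobounded ℂ] fun w => w⁻¹ := by
  refine IsBigO.of_bound 2 ?_
  filter_upwards [tendsto_norm_cobounded_atTop.eventually_ge_atTop (2 * ‖u‖ + 1)] with w hw
  have h1 : ‖w‖ ≤ ‖u + w‖ + ‖u‖ := by
    simpa using norm_sub_le (u + w) u
  have h0 := norm_nonneg u
  rw [norm_inv, norm_inv, inv_eq_one_div, inv_eq_one_div, mul_one_div,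
    div_le_div_iff₀ (by linarith) (by linarith)]
  linarith

/-- The coefficient of `-1/w` in the subtraction making `(u + w)⁻ᵏ` of order `w⁻³`. -/
noncomputable def subOne (k : ℕ) : ℂ := if k = 1 then 1 else 0

/-- The coefficient of `1/w²` in the subtraction making `(u + w)⁻ᵏ` of order `w⁻³`. -/
noncomputable def subTwo (k : ℕ) (u : ℂ) : ℂ := if k = 1 then u else if k = 2 then -1 else 0

/-- The summand `(u + w)⁻ᵏ` with its terms of order `w⁻¹` and `w⁻²` removed. -/
noncomputable def regSummand (k : ℕ) (u w : ℂ) : ℂ :=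
  ((u + w) ^ k)⁻¹ - subOne k * w⁻¹ + subTwo k u * (w ^ 2)⁻¹

theorem isBigO_regSummand {k : ℕ} (hk : 1 ≤ k) (u : ℂ) :
    (fun w => regSummand k u w) =O[Bornology.cobounded ℂ] fun w => w⁻¹ ^ 3 := by
  have h0 : ∀ᶠ w in Bornology.cobounded ℂ, w ≠ 0 := by
    filter_upwards [tendsto_norm_cobounded_atTop.eventually_gt_atTop 0] with w hw
    exact norm_pos_iff.mp hw
  have hu : ∀ᶠ w in Bornology.cobounded ℂ, u + w ≠ 0 := by
    filter_upwards [tendsto_norm_cobounded_atTop.eventually_gt_atTop ‖u‖] with w hw h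
    rw [← neg_eq_of_add_eq_zero_right h, norm_neg] at hw
    exact lt_irrefl _ hw
  have H := isBigO_add_inv_cobounded u
  have R := isBigO_refl (fun w : ℂ => w⁻¹) (Bornology.cobounded ℂ)
  obtain rfl | rfl | hk3 : k = 1 ∨ k = 2 ∨ 3 ≤ k := by omega
  -- `1/(u+w) - 1/w + u/w² = u² / (w²(u+w))`.
  · have := ((R.pow 2).mul H).const_mul_left (u ^ 2)
    refine (this.congr' ?_ ?_)
    · filter_upwards [h0, hu] with w h1 h2
      simp [regSummand, subOne, subTwo]
      field_simp
      ring
    · filter_upwards with w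
      ring
  -- `1/(u+w)² - 1/w² = -u/(w²(u+w)) - u/(w(u+w)²)`.
  · have := (((R.mul (R.mul H))).const_mul_left (-u)).add
      (((R.mul (H.mul H))).const_mul_left (-u))
    refine (this.congr' ?_ ?_)
    · filter_upwards [h0, hu] with w h1 h2
      simp [regSummand, subOne, subTwo]
      field_simp
      ring
    · filter_upwards with w
      ring
  · have h1 : (fun w => regSummand k u w) = fun w => (u + w)⁻¹ ^ k := by
      ext w
      simp [regSummand, subOne, subTwo, show k ≠ 1 by omega, show k ≠ 2 by omega]
    rw [h1]
    refine (H.pow k).trans ?_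
    refine IsBigO.of_bound 1 ?_
    have hb : ∀ᶠ w in Bornology.cobounded ℂ, 1 ≤ ‖w‖ :=
      tendsto_norm_cobounded_atTop.eventually_ge_atTop 1
    filter_upwards [hb] with w hw
    rw [one_mul, norm_pow, norm_pow, norm_inv]
    exact pow_le_pow_of_le_one (by positivity) (inv_le_one_of_one_le₀ hw) hk3

theorem tendsto_lattice_cobounded (z : ℍ) :
    Tendsto (fun x : Fin 2 → ℤ => (x 0 : ℂ) * z + x 1) cofinite (Bornology.cobounded ℂ) := by
  rw [← tendsto_norm_atTop_iff_cobounded]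
  have h1 : Tendsto (fun x : Fin 2 → ℤ => ‖x‖) cofinite atTop :=
    tendsto_norm_comp_cofinite_atTop_of_isClosedEmbedding IsClosedEmbedding.id
  refine tendsto_atTop_mono' _ ?_ (h1.const_mul_atTop (EisensteinSeries.r_pos z))
  have : ∀ᶠ x : Fin 2 → ℤ in cofinite, x ≠ 0 := by
    exact (Set.finite_singleton (0 : Fin 2 → ℤ)).compl_mem_cofinite
  filter_upwards [this] with x hx
  exact EisensteinSeries.r_mul_max_le z hx

theorem summable_regSummand {k : ℕ} (hk : 1 ≤ k) (u : ℂ) (z : ℍ) :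
    Summable fun p : ℤ × ℤ => regSummand k u (p.1 * z + p.2) := by
  have h1 : (fun x : Fin 2 → ℤ => regSummand k u (x 0 * z + x 1)) =O[cofinite]
      fun x => (‖x‖ ^ (3 : ℝ))⁻¹ := by
    refine ((isBigO_regSummand hk u).comp_tendsto (tendsto_lattice_cobounded z)).trans ?_
    have := (EisensteinSeries.isBigO_linear_add_const_vec z 0 0).pow 3
    simpa [Function.comp_def] using this
  have h2 := EisensteinSeries.summable_of_isBigO_rpow_norm (by norm_num) h1
  rw [← (finTwoArrowEquiv ℤ).symm.summable_iff] at h2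
  exact h2

/-! ### Symmetric sums over the integers and the Lipschitz formula -/

theorem sum_Icc_neg_self (f : ℤ → ℂ) (N : ℕ) :
    ∑ i ∈ Icc (-(N : ℤ)) N, f i
      = f 0 + ∑ i ∈ range N, (f ((i : ℤ) + 1) + f (-((i : ℤ) + 1))) := by
  induction N with
  | zero => simp
  | succ n ih =>
    rw [sum_range_succ, ← add_assoc, ← ih]
    push_cast
    rw [sum_Icc_succ_eq_add_endpoints, add_comm]

theorem hasSum_symmetricIcc_of_hasSum_nat {f : ℤ → ℂ} {S : ℂ}
    (h : HasSum (fun n : ℕ => f ((n : ℤ) + 1) + f (-((n : ℤ) + 1))) S) :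
    HasSum f (f 0 + S) (symmetricIcc ℤ) := by
  rw [hasSum_symmetricIcc_iff]
  simp_rw [sum_Icc_neg_self]
  exact h.tendsto_sum_nat.const_add _

theorem hasSum_symmetricIcc_of_hasSum {f : ℤ → ℂ} {S : ℂ} (h : HasSum f S) :
    HasSum f S (symmetricIcc ℤ) :=
  h.mono_left (symmetricIcc ℤ).le_atTop

/-- The sum `∑ (z + d)⁻ᵏ` over the integers `d`, in symmetric order. -/
noncomputable def symInvPow (k : ℕ) (z : ℂ) : ℂ :=
  ∑'[symmetricIcc ℤ] d : ℤ, ((z + d) ^ k)⁻¹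

theorem summable_inv_add_int_pow {k : ℕ} (hk : 2 ≤ k) (z : ℂ) :
    Summable fun d : ℤ => ((z + d) ^ k)⁻¹ := by
  simpa using EisensteinSeries.linear_right_summable z 1 (k := k) (by exact_mod_cast hk)

theorem hasSum_symInvPow_of_two_le {k : ℕ} (hk : 2 ≤ k) (z : ℂ) :
    HasSum (fun d : ℤ => ((z + d) ^ k)⁻¹) (symInvPow k z) := by
  have h := (summable_inv_add_int_pow hk z).hasSum
  rwa [symInvPow, (hasSum_symmetricIcc_of_hasSum h).tsum_eq]

/-- Pairing `d` with `-d` gives the Mittag-Leffler expansion of the cotangent. -/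
theorem hasSum_inv_add_int {z : ℂ} (hz : z ∈ integerComplement) :
    HasSum (fun d : ℤ => ((z + d) ^ 1)⁻¹) (Real.pi * cot (Real.pi * z)) (symmetricIcc ℤ) := by
  have h := (summable_cotTerm hz).hasSum
  rw [← cot_series_rep' hz] at h
  have := hasSum_symmetricIcc_of_hasSum_nat (f := fun d : ℤ => ((z + d) ^ 1)⁻¹)
    (S := Real.pi * cot (Real.pi * z) - 1 / z) (by
      convert h using 2 with n
      push_cast
      simp only [pow_one, cotTerm, one_div, sub_eq_add_neg]
      ring)
  simpa using this

theorem hasSum_inv_int : HasSum (fun d : ℤ => (((0 : ℂ) + d) ^ 1)⁻¹) 0 (symmetricIcc ℤ) := by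
  have := hasSum_symmetricIcc_of_hasSum_nat (f := fun d : ℤ => (((0 : ℂ) + d) ^ 1)⁻¹)
    (S := 0) (by
      convert hasSum_zero using 2 with n
      push_cast
      rw [zero_add, zero_add, pow_one, pow_one, inv_neg, add_neg_cancel])
  simpa using this

theorem symInvPow_one {z : ℂ} (hz : z ∈ integerComplement) :
    symInvPow 1 z = Real.pi * cot (Real.pi * z) :=
  (hasSum_inv_add_int hz).tsum_eq

theorem symInvPow_one_zero : symInvPow 1 0 = 0 :=
  hasSum_inv_int.tsum_eq

/-- The value `z = 0` is admitted because `0⁻¹ = 0` silently drops the singular term `d = 0`; this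
is what handles the origin of the lattice below. -/
theorem hasSum_symInvPow {k : ℕ} (hk : 1 ≤ k) {z : ℂ} (hz : z = 0 ∨ z ∈ integerComplement) :
    HasSum (fun d : ℤ => ((z + d) ^ k)⁻¹) (symInvPow k z) (symmetricIcc ℤ) := by
  rcases hk.eq_or_lt with rfl | hk
  · rcases hz with rfl | hz
    · rw [symInvPow_one_zero]
      exact hasSum_inv_int
    · rw [symInvPow_one hz]
      exact hasSum_inv_add_int hz
  · exact hasSum_symmetricIcc_of_hasSum (hasSum_symInvPow_of_two_le hk z)

theorem hasSum_comp_neg_symmetricIcc {f : ℤ → ℂ} {S : ℂ} (h : HasSum f S (symmetricIcc ℤ)) :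
    HasSum (fun d => f (-d)) S (symmetricIcc ℤ) := by
  rw [hasSum_symmetricIcc_iff] at h ⊢
  refine h.congr fun N => ?_
  rw [sum_Icc_neg_self, sum_Icc_neg_self]
  simp [add_comm]

theorem symInvPow_neg {k : ℕ} (hk : 1 ≤ k) {z : ℂ} (hz : z = 0 ∨ z ∈ integerComplement) :
    symInvPow k (-z) = (-1) ^ k * symInvPow k z := by
  have h := (hasSum_comp_neg_symmetricIcc (hasSum_symInvPow hk hz)).mul_left ((-1) ^ k)
  rw [symInvPow, ← h.tsum_eq]
  refine tsum_congr fun d => ?_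
  rw [← inv_neg_one, inv_pow, ← mul_inv, ← mul_pow]
  push_cast
  ring_nf

theorem mem_integerComplement_of_im_ne_zero {z : ℂ} (hz : z.im ≠ 0) : z ∈ integerComplement := by
  rintro ⟨n, rfl⟩
  simp at hz

/-- The series `∑ n^(k-1) e(nz)` over `n ≥ 1`. -/
noncomputable def powExpSeries (k : ℕ) (z : ℂ) : ℂ :=
  ∑' n : ℕ+, (n : ℂ) ^ (k - 1) * cexp (2 * Real.pi * I * z) ^ (n : ℕ)

/-- The factor `(-2πi)ᵏ / (k-1)!` of the Lipschitz formula. -/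
noncomputable def lipschitzFactor (k : ℕ) : ℂ :=
  (-2 * Real.pi * I) ^ k / ((k - 1).factorial : ℂ)

theorem symInvPow_eq_powExpSeries {k : ℕ} (hk : 1 ≤ k) {z : ℂ} (hz : 0 < z.im) :
    symInvPow k z = -(if k = 1 then Real.pi * I else 0) + lipschitzFactor k * powExpSeries k z := by
  rcases hk.eq_or_lt with rfl | hk
  -- The cotangent expansion is `πi - 2πi ∑ qⁿ` over `n ≥ 0`; splitting off `n = 0` leaves `-πi`.
  · rw [symInvPow_one (mem_integerComplement_of_im_ne_zero hz.ne'),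
      pi_mul_cot_pi_q_exp ⟨z, hz⟩, ← tsum_zero_pnat_eq_tsum_nat]
    · simp [powExpSeries, lipschitzFactor]
      ring
    · have := norm_exp_two_pi_I_lt_one ⟨z, hz⟩
      exact summable_geometric_of_norm_lt_one this
  · have := EisensteinSeries.qExpansion_identity_pnat (k := k - 1) (by omega) ⟨z, hz⟩
    rw [Nat.sub_add_cancel (by omega)] at this
    rw [← (hasSum_symInvPow_of_two_le hk z).tsum_eq]
    simpa [hk.ne', powExpSeries, lipschitzFactor] using this

/-! ### The lattice sum by rows and by columns -/

theorem e2Summand_eq_symInvPow (m : ℤ) (z : ℍ) :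
    EisensteinSeries.e2Summand m z = symInvPow 2 (m * z) := by
  rw [← (hasSum_symInvPow_of_two_le le_rfl _).tsum_eq, EisensteinSeries.e2Summand]
  simp [EisensteinSeries.eisSummand, zpow_neg, zpow_ofNat]

theorem hasSum_symInvPow_two (z : ℍ) :
    HasSum (fun m : ℤ => symInvPow 2 (m * z)) (EisensteinSeries.G2 z) (symmetricIcc ℤ) := by
  simp_rw [← e2Summand_eq_symInvPow]
  exact (EisensteinSeries.summable_e2Summand_symmetricIcc z).hasSum

/-- The real line through `z` meets the real axis only at `0`. -/
theorem add_int_mul_admissible (x : ℝ) {z : ℂ} (hz : z.im ≠ 0)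
    (m : ℤ) : (x * z + m * z = 0) ∨ (x * z + m * z) ∈ integerComplement := by
  by_cases h : x + m = 0
  · left
    rw [← add_mul]
    have : ((x : ℂ) + m) = ((x + m : ℝ) : ℂ) := by push_cast; rfl
    rw [this, h]
    simp
  · right
    apply mem_integerComplement_of_im_ne_zero
    have : (x * z + m * z).im = (x + m) * z.im := by
      simp [add_mul]
    rw [this]
    exact mul_ne_zero h hz

/-- The point is real only for `d = 0`, where it is `x`; an `x` in `[0, 1)` is either `0` or not an
integer. -/
theorem add_div_admissible {x : ℝ} (hx0 : 0 ≤ x) (hx1 : x < 1) {z : ℂ} (hz : z.im ≠ 0)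
    (d : ℤ) : (x + d / z = 0) ∨ (x + d / z) ∈ integerComplement := by
  by_cases hd : d = 0
  · subst hd
    rcases hx0.eq_or_lt with rfl | hx0
    · left; simp
    · right
      rintro ⟨n, hn⟩
      have h : (n : ℝ) = x := by
        simp only [Int.cast_zero, zero_div, add_zero] at hn
        exact_mod_cast hn
      rw [← h] at hx0 hx1
      have h0 : 0 < n := by exact_mod_cast hx0
      have h1 : n < 1 := by exact_mod_cast hx1
      omega
  · right
    apply mem_integerComplement_of_im_ne_zero
    have hz0 : z ≠ 0 := by
      rintro rfl
      simp at hz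
    simp [Complex.div_im, hd, hz0, hz]

theorem int_mul_admissible {z : ℂ} (hz : z.im ≠ 0) (m : ℤ) :
    (m * z = 0) ∨ (m * z) ∈ integerComplement := by
  simpa using add_int_mul_admissible 0 hz m

theorem int_div_admissible {z : ℂ} (hz : z.im ≠ 0) (d : ℤ) :
    (d / z = 0) ∨ (d / z) ∈ integerComplement := by
  simpa using add_div_admissible (x := 0) le_rfl one_pos hz d

/-- The terms at `n` and `-n` cancel, so the `w⁻¹` part of the regularisation contributes nothing in
either order of summation. -/
theorem hasSum_symInvPow_one_of_odd {w : ℤ → ℂ} (h0 : w 0 = 0) (hw : ∀ n, w (-n) = -w n)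
    (h : ∀ n, w n = 0 ∨ w n ∈ integerComplement) :
    HasSum (fun m : ℤ => symInvPow 1 (w m)) 0 (symmetricIcc ℤ) := by
  have := hasSum_symmetricIcc_of_hasSum_nat (f := fun m : ℤ => symInvPow 1 (w m)) (S := 0) (by
    convert hasSum_zero using 2 with n
    rw [hw, symInvPow_neg le_rfl (h _)]
    ring)
  simpa [h0, symInvPow_one_zero] using this

theorem hasSum_symInvPow_row {k : ℕ} (hk : 1 ≤ k) (x : ℝ) (z : ℍ) :
    HasSum (fun m : ℤ => symInvPow k (x * z + m * z))
      ((∑' p : ℤ × ℤ, regSummand k (x * z) (p.1 * z + p.2))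
        - subTwo k (x * z) * EisensteinSeries.G2 z) (symmetricIcc ℤ) := by
  have hs := summable_regSummand hk (x * z) z
  have hz : (z : ℂ).im ≠ 0 := z.im_ne_zero
  have hrow : ∀ m : ℤ, ∑' d : ℤ, regSummand k (x * z) (m * z + d)
      = symInvPow k (x * z + m * z) - subOne k * symInvPow 1 (m * z)
        + subTwo k (x * z) * symInvPow 2 (m * z) := by
    intro m
    -- The row converges absolutely, so its sum is also the symmetric limit, and there the three
    -- pieces of `regSummand` converge separately.
    have h1 := hasSum_symmetricIcc_of_hasSum (hs.prod_factor m).hasSum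
    refine h1.unique ?_
    have := ((hasSum_symInvPow hk (add_int_mul_admissible x hz m)).sub
      ((hasSum_symInvPow le_rfl (int_mul_admissible hz m)).mul_left (subOne k))).add
      ((hasSum_symInvPow one_le_two (int_mul_admissible hz m)).mul_left (subTwo k (x * z)))
    simpa [regSummand, add_assoc] using this
  have h1 := hasSum_symmetricIcc_of_hasSum hs.prod.hasSum
  rw [← hs.tsum_prod] at h1
  simp only [hrow] at h1
  have h2 := hasSum_symInvPow_one_of_odd (w := fun m : ℤ => m * z) (by simp) (by simp)
    (int_mul_admissible hz)
  have h3 := (h1.add (h2.mul_left (subOne k))).sub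
    ((hasSum_symInvPow_two z).mul_left (subTwo k (x * z)))
  rw [mul_zero, add_zero] at h3
  refine h3.congr_fun fun m => ?_
  ring

theorem hasSum_symInvPow_col {k : ℕ} (hk : 1 ≤ k) {x : ℝ} (hx0 : 0 ≤ x) (hx1 : x < 1) (z : ℍ) :
    HasSum (fun d : ℤ => ((z : ℂ) ^ k)⁻¹ * symInvPow k (x + d / z))
      ((∑' p : ℤ × ℤ, regSummand k (x * z) (p.1 * z + p.2))
        - subTwo k (x * z) * (((z : ℂ) ^ 2)⁻¹ * EisensteinSeries.G2 (ModularGroup.S • z)))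
      (symmetricIcc ℤ) := by
  have hs := summable_regSummand hk (x * z) z
  have hs' : Summable fun p : ℤ × ℤ => regSummand k (x * z) (p.2 * z + p.1) := hs.prod_symm
  have ht : ∑' p : ℤ × ℤ, regSummand k (x * z) (p.2 * z + p.1)
      = ∑' p : ℤ × ℤ, regSummand k (x * z) (p.1 * z + p.2) :=
    (Equiv.prodComm ℤ ℤ).tsum_eq (fun p : ℤ × ℤ => regSummand k (x * z) (p.1 * z + p.2))
  have hz : (z : ℂ).im ≠ 0 := z.im_ne_zero
  have hz0 : (z : ℂ) ≠ 0 := ne_zero z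
  have hcol : ∀ d : ℤ, ∑' m : ℤ, regSummand k (x * z) (m * z + d)
      = ((z : ℂ) ^ k)⁻¹ * symInvPow k (x + d / z) - subOne k * ((z : ℂ)⁻¹ * symInvPow 1 (d / z))
        + subTwo k (x * z) * (((z : ℂ) ^ 2)⁻¹ * symInvPow 2 (d / z)) := by
    intro d
    have h1 := hasSum_symmetricIcc_of_hasSum (hs'.prod_factor d).hasSum
    refine h1.unique ?_
    have := (((hasSum_symInvPow hk (add_div_admissible hx0 hx1 hz d)).mul_left
      ((z : ℂ) ^ k)⁻¹).sub
      (((hasSum_symInvPow le_rfl (int_div_admissible hz d)).mul_left (z : ℂ)⁻¹).mul_left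
        (subOne k))).add
      (((hasSum_symInvPow one_le_two (int_div_admissible hz d)).mul_left
        ((z : ℂ) ^ 2)⁻¹).mul_left (subTwo k (x * z)))
    refine this.congr_fun fun m => ?_
    -- Each column is a symmetric sum over `m` once `z` is factored out of `mz + d` and `xz + mz +
    -- d`.
    have e1 : (d / z + m : ℂ) = (z : ℂ)⁻¹ * (m * z + d) := by field_simp; ring
    have e2 : (x + d / z + m : ℂ) = (z : ℂ)⁻¹ * (x * z + (m * z + d)) := by field_simp; ring
    simp only [regSummand, e1, e2, mul_pow, mul_inv, inv_pow, inv_inv, pow_one]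
    rw [inv_mul_cancel_left₀ (pow_ne_zero _ hz0), inv_mul_cancel_left₀ (pow_ne_zero _ hz0),
      inv_mul_cancel_left₀ hz0]
  have h1 := hasSum_symmetricIcc_of_hasSum hs'.prod.hasSum
  rw [← hs'.tsum_prod, ht] at h1
  simp only [hcol] at h1
  have h2 := hasSum_symInvPow_one_of_odd (w := fun m : ℤ => m / z) (by simp)
    (by simp [neg_div]) (int_div_admissible hz)
  -- `S • z = -1/z`, and the sign is harmless because `symInvPow 2` is even.
  have h4 : HasSum (fun d : ℤ => symInvPow 2 (d / z)) (EisensteinSeries.G2 (ModularGroup.S • z))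
      (symmetricIcc ℤ) := by
    convert hasSum_symInvPow_two (ModularGroup.S • z) using 2 with d
    rw [modular_S_smul]
    have : (d : ℂ) * ((UpperHalfPlane.mk (-(z : ℂ))⁻¹ z.im_inv_neg_coe_pos : ℍ) : ℂ)
        = -(d / z) := by
      simp [div_eq_mul_inv, inv_neg]
    rw [this, symInvPow_neg one_le_two (int_div_admissible hz d)]
    simp
  have h3 := (h1.add ((h2.mul_left (z : ℂ)⁻¹).mul_left (subOne k))).sub
    ((h4.mul_left ((z : ℂ) ^ 2)⁻¹).mul_left (subTwo k (x * z)))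
  rw [mul_zero, mul_zero, add_zero] at h3
  refine h3.congr_fun fun m => ?_
  ring

/-- Interchanging the two orders of summation in the lattice sum `∑ (xz + mz + d)⁻ᵏ`. -/
theorem tsum_row_sub_tsum_col {k : ℕ} (hk : 1 ≤ k) {x : ℝ} (hx0 : 0 ≤ x) (hx1 : x < 1) (z : ℍ)
    {A B : ℂ}
    (hA : HasSum (fun m : ℤ => symInvPow k (x * z + m * z)) A (symmetricIcc ℤ))
    (hB : HasSum (fun d : ℤ => symInvPow k (x + d / z)) B (symmetricIcc ℤ)) :
    (z : ℂ) ^ k * A = B - (z : ℂ) ^ k * (subTwo k (x * z) * (2 * Real.pi * I / z)) := by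
  have hz0 : (z : ℂ) ^ k ≠ 0 := pow_ne_zero _ (ne_zero z)
  have h1 := hA.unique (hasSum_symInvPow_row hk x z)
  have h2 := (hB.mul_left ((z : ℂ) ^ k)⁻¹).unique (hasSum_symInvPow_col hk hx0 hx1 z)
  rw [inv_mul_eq_iff_eq_mul₀ hz0] at h2
  rw [h1, h2, EisensteinSeries.G2_S_transform z]
  ring

/-! ### Lambert series -/

theorem norm_cexp_two_pi_I_mul (z : ℂ) :
    ‖cexp (2 * Real.pi * I * z)‖ = Real.exp (-(2 * Real.pi * z.im)) := by
  rw [norm_exp]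
  congr 1
  simp

theorem cexp_two_pi_I_mul_pow (z : ℂ) (n : ℕ) :
    cexp (2 * Real.pi * I * z) ^ n = cexp (2 * Real.pi * I * (n * z)) := by
  rw [← Complex.exp_nat_mul]
  ring_nf

/-- The terms are dominated by `C nᵏ r^(mn)` with `r = e^(-2πy) < 1`. Only a linear lower bound on
the imaginary parts is used, so that the shifted points `mz ± xz` are covered as well. -/
theorem summable_lambert (k : ℕ) {w : ℕ+ → ℂ} {y : ℝ} (hy : 0 < y)
    (hw : ∀ m : ℕ+, y * m ≤ (w m).im) {a : ℕ+ → ℕ+ → ℂ} {C : ℝ} (ha : ∀ m n, ‖a m n‖ ≤ C) :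
    Summable fun p : ℕ+ × ℕ+ =>
      a p.1 p.2 * ((p.2 : ℂ) ^ k * cexp (2 * Real.pi * I * w p.1) ^ (p.2 : ℕ)) := by
  set r : ℝ := Real.exp (-(2 * Real.pi * y)) with hr
  have hr1 : ‖r‖ < 1 := by
    rw [Real.norm_of_nonneg (Real.exp_pos _).le, Real.exp_lt_one_iff]
    have := Real.pi_pos
    simp only [Left.neg_neg_iff]
    positivity
  have hC : 0 ≤ C := (norm_nonneg _).trans (ha 1 1)
  refine Summable.of_norm_bounded ((summable_prod_mul_pow k hr1).mul_left C) fun p => ?_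
  rw [norm_mul, norm_mul, norm_pow, norm_pow, Complex.norm_natCast, norm_cexp_two_pi_I_mul, pow_mul]
  have h1 : Real.exp (-(2 * Real.pi * (w p.1).im)) ≤ r ^ (p.1 : ℕ) := by
    rw [hr, ← Real.exp_nat_mul, Real.exp_le_exp]
    have := mul_le_mul_of_nonneg_left (hw p.1) Real.two_pi_pos.le
    linarith
  gcongr
  exact ha _ _

theorem summable_powExp (k : ℕ) {z : ℂ} (hz : 0 < z.im) :
    Summable fun n : ℕ+ => (n : ℂ) ^ k * cexp (2 * Real.pi * I * z) ^ (n : ℕ) := by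
  have h := (summable_lambert k (w := fun m => m * z) hz (fun m => by simp [mul_comm])
    (a := fun _ _ => 1) (C := 1) (by simp)).prod_factor 1
  simpa using h

theorem summable_powExpSeries (k : ℕ) {w : ℕ+ → ℂ} {y : ℝ} (hy : 0 < y)
    (hw : ∀ m : ℕ+, y * m ≤ (w m).im) : Summable fun m => powExpSeries k (w m) := by
  have h := (summable_lambert (k - 1) hy hw (a := fun _ _ => 1) (C := 1) (by simp)).prod
  simpa [powExpSeries] using h

theorem tsum_lambert (k : ℕ) {z : ℂ} (hz : 0 < z.im) (a : ℕ → ℕ → ℂ) {C : ℝ}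
    (ha : ∀ m n, ‖a m n‖ ≤ C) :
    ∑' (d : ℕ+) (n : ℕ+), a d n * ((n : ℂ) ^ k * cexp (2 * Real.pi * I * (d * z)) ^ (n : ℕ))
      = ∑' m : ℕ+, (∑ n ∈ (m : ℕ).divisors, a (m / n) n * (n : ℂ) ^ k)
          * cexp (2 * Real.pi * I * z) ^ (m : ℕ) := by
  have hs := summable_lambert k (w := fun m => m * z) hz (fun m => by simp [mul_comm])
    (a := fun m n => a m n) (C := C) (fun _ _ => ha _ _)
  rw [← hs.tsum_prod, ← sigmaAntidiagonalEquivProd.tsum_eq]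
  rw [← sigmaAntidiagonalEquivProd.summable_iff] at hs
  refine hs.tsum_sigma.trans (tsum_congr fun m => ?_)
  rw [tsum_fintype]
  simp only [Function.comp_apply, sigmaAntidiagonalEquivProd, divisorsAntidiagonalFactors,
    Equiv.coe_fn_mk, PNat.mk_coe, univ_eq_attach]
  rw [(m : ℕ).divisorsAntidiagonal.sum_attach (fun x : ℕ × ℕ => a x.1 x.2 *
    ((x.2 : ℂ) ^ k * cexp (2 * Real.pi * I * (x.1 * z)) ^ x.2)),
    Nat.sum_divisorsAntidiagonal' (fun x y => a x y *
    ((y : ℂ) ^ k * cexp (2 * Real.pi * I * (x * z)) ^ y)), sum_mul]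
  refine sum_congr rfl fun n hn => ?_
  rw [← cexp_two_pi_I_mul_pow, ← pow_mul, Nat.div_mul_cancel (Nat.dvd_of_mem_divisors hn)]
  ring

/-! ### Residue classes and the finite Fourier transform of `χ` -/

theorem sum_zmod_eq_sum_range {N : ℕ} [NeZero N] (g : ℕ → ℂ) :
    ∑ j : ZMod N, g j.val = ∑ b ∈ range N, g b := by
  obtain ⟨n, rfl⟩ := Nat.exists_eq_succ_of_ne_zero (NeZero.ne N)
  exact Fin.sum_univ_eq_sum_range g (n + 1)

theorem sum_zmod_eq_sum_range_cast {N : ℕ} [NeZero N] (g : ZMod N → ℂ) :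
    ∑ j : ZMod N, g j = ∑ b ∈ range N, g b := by
  rw [← sum_zmod_eq_sum_range (fun b => g b)]
  simp

theorem tsum_eq_sum_residues (N : ℕ) [NeZero N] {F : ℕ → ℂ} (hF : Summable F) (h0 : F 0 = 0) :
    ∑' n : ℕ+, F n = ∑ b ∈ range N, (F b + ∑' m : ℕ+, F (N * m + b)) := by
  rw [← zero_add (∑' n : ℕ+, F n), ← h0, tsum_zero_pnat_eq_tsum_nat hF,
    Nat.sumByResidueClasses hF N,
    sum_zmod_eq_sum_range (fun b => ∑' m, F (b + N * m))]
  refine sum_congr rfl fun b _ => ?_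
  have hs : Summable fun m => F (b + N * m) := hF.comp_injective fun m n h => by
    simpa [NeZero.ne N] using h
  rw [← tsum_zero_pnat_eq_tsum_nat hs]
  simp [add_comm]

theorem tsum_eq_sum_neg_residues (N : ℕ) [NeZero N] {F : ℕ → ℂ} (hF : Summable F) :
    ∑' n : ℕ+, F n = ∑ b ∈ range N, ∑' m : ℕ+, F (N * m - b) := by
  -- Classes are taken for `n - 1` and then reflected by `b ↦ N - 1 - b`, since `(N - 1 - b) + Nm +
  -- 1 = N(m + 1) - b`.
  rw [tsum_pnat_eq_tsum_succ (f := F), Nat.sumByResidueClasses ((summable_nat_add_iff 1).mpr hF) N,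
    sum_zmod_eq_sum_range (fun b => ∑' m, F (b + N * m + 1)), ← sum_range_reflect]
  refine sum_congr rfl fun b hb => ?_
  rw [tsum_pnat_eq_tsum_succ (f := fun m => F (N * m - b))]
  refine tsum_congr fun m => ?_
  congr 1
  rw [mem_range] at hb
  rw [mul_add]
  omega

theorem sum_Icc_one_natCast {N : ℕ} [NeZero N] (g : ZMod N → ℂ) :
    ∑ a ∈ Icc 1 N, g a = ∑ j, g j := by
  have h1 : Icc 1 N = Ico 1 (N + 1) := by
    ext
    simp
  have h2 := sum_range_succ (fun a : ℕ => g a) N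
  rw [sum_range_succ'] at h2
  rw [h1, sum_Ico_eq_sum_range, sum_zmod_eq_sum_range_cast]
  simp only [Nat.cast_zero, CharP.cast_eq_zero, add_left_inj] at h2
  simpa [add_comm] using h2

open ZMod in
theorem charFourier_eq_dft {N : ℕ} [NeZero N] (χ : DirichletCharacter ℂ N) (b : ℕ) :
    charFourier χ b = 𝓕 χ (b : ZMod N) := by
  have h1 : charFourier χ b
      = ∑ a ∈ Icc 1 N, (fun j : ZMod N => χ (-j) * stdAddChar (j * (b : ZMod N))) a := by
    refine sum_congr rfl fun a _ => ?_
    have := stdAddChar_coe (N := N) ((a : ℤ) * b)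
    push_cast at this
    simp only [this]
    congr 2
    ring
  rw [h1, dft_apply]
  refine (sum_Icc_one_natCast (fun j : ZMod N => χ (-j) * stdAddChar (j * (b : ZMod N)))).trans ?_
  refine Fintype.sum_equiv (Equiv.neg _) _ _ fun j => ?_
  simp [mul_comm]

open ZMod in
-- Fourier inversion on `ZMod N`: transforming twice gives `N χ(-j)`. Primitivity of `χ` plays no
-- role.
theorem sum_charFourier_mul {N : ℕ} [NeZero N] (χ : DirichletCharacter ℂ N) (n : ℤ) :
    ∑ b ∈ range N, charFourier χ b * cexp (2 * Real.pi * I * (n * (b / N)))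
      = N * χ (n : ZMod N) := by
  have h := congr_fun (dft_dft (χ : ZMod N → ℂ)) (-(n : ZMod N))
  rw [dft_apply, neg_neg] at h
  rw [smul_eq_mul] at h
  rw [← h, sum_zmod_eq_sum_range_cast]
  refine sum_congr rfl fun b _ => ?_
  have := stdAddChar_coe (N := N) ((b : ℤ) * n)
  push_cast at this
  rw [mul_neg, neg_neg, this, charFourier_eq_dft, smul_eq_mul, mul_comm]
  congr 2
  ring

theorem charFourier_mul_add {N : ℕ} [NeZero N] (χ : DirichletCharacter ℂ N) (m b : ℕ) :
    charFourier χ (N * m + b) = charFourier χ b := by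
  simp [charFourier_eq_dft]

open ZMod in
-- The Fourier transform preserves parity.
theorem charFourier_mul_sub {N : ℕ} [NeZero N] {χ : DirichletCharacter ℂ N} {k : ℕ}
    (hχ : χ (-1) = (-1) ^ k) {m b : ℕ} (hb : b ≤ N * m) :
    charFourier χ (N * m - b) = (-1) ^ k * charFourier χ b := by
  have h := congr_fun (dft_comp_neg (χ : ZMod N → ℂ)) (b : ZMod N)
  have h2 : (fun j : ZMod N => χ (-j)) = (((-1 : ℂ) ^ k) • (χ : ZMod N → ℂ)) := by
    ext j
    rw [← neg_one_mul, map_mul, hχ]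
    rfl
  rw [h2, _root_.map_smul] at h
  simp only [charFourier_eq_dft, Nat.cast_sub hb]
  simpa using h.symm

/-! ### The inversion formula for one residue, in exponential series -/

/-- In weight one the constants `-πi` of the two Lipschitz formulas cancel because `symInvPow 1` is
odd. -/
theorem symInvPow_add_symInvPow_neg {k : ℕ} (hk : 1 ≤ k) {p q : ℂ} (hp : 0 < p.im)
    (hq : 0 < q.im) :
    symInvPow k p + symInvPow k (-q)
      = lipschitzFactor k * (powExpSeries k p + (-1) ^ k * powExpSeries k q) := by
  rw [symInvPow_neg hk (Or.inr (mem_integerComplement_of_im_ne_zero hq.ne')),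
    symInvPow_eq_powExpSeries hk hp, symInvPow_eq_powExpSeries hk hq]
  split_ifs with h
  · subst h; ring
  · ring

theorem hasSum_symmetricIcc_symInvPow {k : ℕ} (hk : 1 ≤ k) {f : ℤ → ℂ} {p q : ℕ+ → ℂ} {y : ℝ}
    (hy : 0 < y) (hp : ∀ m : ℕ+, y * m ≤ (p m).im) (hq : ∀ m : ℕ+, y * m ≤ (q m).im)
    (hfp : ∀ m : ℕ+, f m = symInvPow k (p m)) (hfq : ∀ m : ℕ+, f (-m) = symInvPow k (-q m)) :
    HasSum f (f 0 + lipschitzFactor k *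
      (∑' m, powExpSeries k (p m) + (-1) ^ k * ∑' m, powExpSeries k (q m))) (symmetricIcc ℤ) := by
  refine hasSum_symmetricIcc_of_hasSum_nat ?_
  have h := (((summable_powExpSeries k hy hp).hasSum).add
    ((summable_powExpSeries k hy hq).hasSum.mul_left ((-1) ^ k))).mul_left (lipschitzFactor k)
  have h2 : HasSum (fun m : ℕ+ => (fun n : ℕ => f n + f (-n)) m) (lipschitzFactor k *
      (∑' m, powExpSeries k (p m) + (-1) ^ k * ∑' m, powExpSeries k (q m))) := by
    refine h.congr_fun fun m => ?_
    have hm : 0 < y * m := mul_pos hy (by exact_mod_cast m.pos)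
    rw [← symInvPow_add_symInvPow_neg hk (hm.trans_le (hp m)) (hm.trans_le (hq m)), ← hfp, ← hfq]
  simpa using (hasSum_pnat_iff_hasSum_succ (f := fun n : ℕ => f n + f (-n))).mp h2

/-- For `m ≥ 1` both `m + x` and `m - x` are at least `(1 - x) m`. -/
theorem le_im_mul_add {x : ℝ} (hx0 : 0 ≤ x) {z : ℂ} (hz : 0 < z.im) (m : ℕ+) :
    (1 - x) * z.im * m ≤ (m * z + x * z).im ∧ (1 - x) * z.im * m ≤ (m * z - x * z).im := by
  have hm : (1 : ℝ) ≤ m := by exact_mod_cast m.pos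
  have e1 : (m * z + x * z).im = (m + x) * z.im := by simp [add_mul]
  have e2 : (m * z - x * z).im = (m - x) * z.im := by simp [sub_mul]
  rw [e1, e2, mul_right_comm]
  constructor <;> refine mul_le_mul_of_nonneg_right ?_ hz.le <;> nlinarith

theorem hasSum_row {k : ℕ} (hk : 1 ≤ k) {x : ℝ} (hx0 : 0 ≤ x) (hx1 : x < 1) {z : ℂ}
    (hz : 0 < z.im) :
    HasSum (fun m : ℤ => symInvPow k (x * z + m * z))
      (symInvPow k (x * z) + lipschitzFactor k * (∑' m : ℕ+, powExpSeries k (m * z + x * z)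
        + (-1) ^ k * ∑' m : ℕ+, powExpSeries k (m * z - x * z))) (symmetricIcc ℤ) := by
  have h := hasSum_symmetricIcc_symInvPow hk (f := fun m : ℤ => symInvPow k (x * z + m * z))
    (p := fun m => m * z + x * z) (q := fun m => m * z - x * z) (y := (1 - x) * z.im)
    (mul_pos (by linarith) hz) (fun m => (le_im_mul_add hx0 hz m).1)
    (fun m => (le_im_mul_add hx0 hz m).2)
    (fun m => by push_cast; ring_nf) (fun m => by push_cast; ring_nf)
  simpa using h

theorem im_neg_one_div_pos {z : ℂ} (hz : 0 < z.im) : 0 < (-1 / z).im := by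
  rw [neg_div, one_div, neg_im, inv_im, neg_div, neg_neg]
  exact div_pos hz (normSq_pos.mpr (by rintro rfl; simp at hz))

theorem hasSum_col {k : ℕ} (hk : 1 ≤ k) (x : ℝ) {z : ℂ} (hz : 0 < z.im) :
    HasSum (fun d : ℤ => symInvPow k (x + d / z))
      (symInvPow k x + lipschitzFactor k * (∑' d : ℕ+, powExpSeries k (d * (-1 / z) + x)
        + (-1) ^ k * ∑' d : ℕ+, powExpSeries k (d * (-1 / z) - x))) (symmetricIcc ℤ) := by
  have him : 0 < (-1 / z).im := im_neg_one_div_pos hz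
  -- The sign of `d` is flipped so that positive `d` lands in the upper half-plane; the symmetric
  -- sum does not change.
  have h := hasSum_symmetricIcc_symInvPow hk (f := fun d : ℤ => symInvPow k (x - d / z))
    (p := fun d => d * (-1 / z) + x) (q := fun d => d * (-1 / z) - x) him
    (fun m => by simp [mul_comm]) (fun m => by simp [mul_comm])
    (fun m => by push_cast; ring_nf) (fun m => by push_cast; ring_nf)
  simpa [neg_div] using hasSum_comp_neg_symmetricIcc h

theorem inversion_residue {k : ℕ} (hk : 1 ≤ k) {x : ℝ} (hx0 : 0 ≤ x) (hx1 : x < 1) {z : ℂ}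
    (hz : 0 < z.im) :
    z ^ k * (symInvPow k (x * z) + lipschitzFactor k * (∑' m : ℕ+, powExpSeries k (m * z + x * z)
        + (-1) ^ k * ∑' m : ℕ+, powExpSeries k (m * z - x * z)))
      = symInvPow k x + lipschitzFactor k * (∑' d : ℕ+, powExpSeries k (d * (-1 / z) + x)
        + (-1) ^ k * ∑' d : ℕ+, powExpSeries k (d * (-1 / z) - x))
        - z ^ k * (subTwo k (x * z) * (2 * Real.pi * I / z)) :=
  tsum_row_sub_tsum_col hk hx0 hx1 ⟨z, hz⟩ (hasSum_row hk hx0 hx1 hz) (hasSum_col hk x hz)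

/-! ### Summation over residues weighted by the Fourier transform of `χ` -/

/-- The contribution of the residue `b` to the constant term of `Ê_{k,χ}`. -/
noncomputable def residueConst {N : ℕ} (k : ℕ) (χ : DirichletCharacter ℂ N) (b : ℕ) : ℂ :=
  if b = 0 then charFourier χ 0 * symInvPow k 0
  else -(if k = 1 then Real.pi * I else 0) * charFourier χ b

theorem summable_charFourier_powExpSeries {N : ℕ} (χ : DirichletCharacter ℂ N) (k : ℕ) {τ : ℂ}
    (hτ : 0 < τ.im) : Summable fun n : ℕ+ => charFourier χ n * powExpSeries k (n * τ) := by
  have h := (summable_lambert (k - 1) (w := fun m => m * τ) hτ (fun m => by simp [mul_comm])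
    (a := fun m _ => charFourier χ m) (C := N) (fun m _ => norm_charFourier_le χ m)).prod
  simpa [powExpSeries, tsum_mul_left] using h

/-- As `b` varies, `b` and `Nm + b` run through all positive integers (apart from `b = 0`), and so
do the `Nm - b`. Periodicity and parity of `charFourier χ` give both families the same weights,
whence the factor 2. -/
theorem sum_charFourier_row {N : ℕ} [NeZero N] {k : ℕ} (hk : 1 ≤ k) {χ : DirichletCharacter ℂ N}
    (hχ : χ (-1) = (-1) ^ k) {τ : ℂ} (hτ : 0 < τ.im) :
    ∑ b ∈ range N, charFourier χ b * (symInvPow k (b * τ) + lipschitzFactor k *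
        (∑' m : ℕ+, powExpSeries k ((N * m + b : ℕ) * τ)
          + (-1) ^ k * ∑' m : ℕ+, powExpSeries k ((N * m - b : ℕ) * τ)))
      = ∑ b ∈ range N, residueConst k χ b
        + 2 * lipschitzFactor k * ∑' n : ℕ+, charFourier χ n * powExpSeries k (n * τ) := by
  -- The value at `0` is set to `0` so that the class of `b = 0` starts at `n = N`; the true term at
  -- the origin, `symInvPow k 0`, is kept in `residueConst`.
  set F : ℕ → ℂ := fun n => if n = 0 then 0 else charFourier χ n * powExpSeries k (n * τ) with hF
  have hF0 : F 0 = 0 := by simp [hF]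
  have hFp : ∀ n : ℕ, n ≠ 0 → F n = charFourier χ n * powExpSeries k (n * τ) := by
    intro n hn
    simp [hF, hn]
  have hsum : ∑' n : ℕ+, charFourier χ n * powExpSeries k (n * τ) = ∑' n : ℕ+, F n :=
    tsum_congr fun n => (hFp n n.ne_zero).symm
  have hs : Summable F := by
    have := (summable_charFourier_powExpSeries χ k hτ).congr
      (fun n : ℕ+ => (hFp n n.ne_zero).symm)
    rw [summable_pnat_iff_summable_nat] at this
    exact this
  rw [hsum, two_mul, add_mul]
  nth_rewrite 1 [tsum_eq_sum_residues N hs hF0]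
  rw [tsum_eq_sum_neg_residues N hs, mul_sum, mul_sum, ← sum_add_distrib, ← sum_add_distrib]
  refine sum_congr rfl fun b hb => ?_
  rw [mem_range] at hb
  have h1 : ∑' m : ℕ+, F (N * m + b)
      = charFourier χ b * ∑' m : ℕ+, powExpSeries k ((N * m + b : ℕ) * τ) := by
    rw [← tsum_mul_left]
    refine tsum_congr fun m => ?_
    rw [hFp _ (by have := NeZero.ne N; positivity), charFourier_mul_add]
  have h2 : ∑' m : ℕ+, F (N * m - b)
      = charFourier χ b * ((-1) ^ k * ∑' m : ℕ+, powExpSeries k ((N * m - b : ℕ) * τ)) := by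
    rw [← tsum_mul_left, ← tsum_mul_left]
    refine tsum_congr fun m => ?_
    have hle : N ≤ N * m := Nat.le_mul_of_pos_right _ m.pos
    rw [hFp _ (by omega), charFourier_mul_sub hχ (by omega)]
    ring
  have h3 : charFourier χ b * symInvPow k (b * τ)
      = residueConst k χ b + lipschitzFactor k * F b := by
    by_cases hb0 : b = 0
    · subst hb0
      simp [residueConst, hF0]
    · have : 0 < (b * τ).im := by
        have : (0 : ℝ) < b := by exact_mod_cast Nat.pos_of_ne_zero hb0
        simpa using mul_pos this hτ
      rw [symInvPow_eq_powExpSeries hk this, hFp b hb0, residueConst, if_neg hb0]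
      ring
  rw [h1, h2, mul_add, h3]
  ring

theorem sum_charFourier_powExpSeries {N : ℕ} [NeZero N] (χ : DirichletCharacter ℂ N) (k : ℕ) {w : ℂ}
    (hw : 0 < w.im) :
    ∑ b ∈ range N, charFourier χ b * powExpSeries k (w + b / N)
      = N * ∑' n : ℕ+, χ (n : ZMod N) *
        ((n : ℂ) ^ (k - 1) * cexp (2 * Real.pi * I * w) ^ (n : ℕ)) := by
  simp only [powExpSeries, ← tsum_mul_left]
  rw [← Summable.tsum_finsetSum]
  · refine tsum_congr fun n => ?_
    have := sum_charFourier_mul χ n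
    push_cast at this
    rw [← mul_assoc, ← this, sum_mul]
    refine sum_congr rfl fun b _ => ?_
    rw [cexp_two_pi_I_mul_pow, cexp_two_pi_I_mul_pow, mul_add (n : ℂ), mul_add, Complex.exp_add]
    ring
  · intro b _
    refine (summable_powExp (k - 1) ?_).mul_left _
    have : (b / N : ℂ) = ((b / N : ℝ) : ℂ) := by push_cast; rfl
    rwa [this, add_im, ofReal_im, add_zero]

theorem sum_charFourier_powExpSeries_sub {N : ℕ} [NeZero N] {χ : DirichletCharacter ℂ N} {k : ℕ}
    (hχ : χ (-1) = (-1) ^ k) {w : ℂ} (hw : 0 < w.im) :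
    ∑ b ∈ range N, charFourier χ b * ((-1) ^ k * powExpSeries k (w - b / N))
      = N * ∑' n : ℕ+, χ (n : ZMod N) *
        ((n : ℂ) ^ (k - 1) * cexp (2 * Real.pi * I * w) ^ (n : ℕ)) := by
  simp only [powExpSeries, ← tsum_mul_left]
  rw [← Summable.tsum_finsetSum]
  · refine tsum_congr fun n => ?_
    have := sum_charFourier_mul χ (-n)
    push_cast at this
    -- Inversion at `-n` yields `χ(-n)`, and the parity of `χ` absorbs the sign.
    have h2 : N * χ (n : ZMod N) = (-1) ^ k * (N * χ (-(n : ZMod N))) := by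
      rw [← neg_one_mul (n : ZMod N), map_mul, hχ, mul_left_comm, ← mul_assoc ((-1 : ℂ) ^ k),
        ← mul_pow]
      simp
    rw [← mul_assoc, h2, ← this, mul_sum, sum_mul]
    refine sum_congr rfl fun b _ => ?_
    rw [cexp_two_pi_I_mul_pow, cexp_two_pi_I_mul_pow, sub_eq_add_neg, mul_add (n : ℂ), mul_add,
      Complex.exp_add, mul_neg, neg_mul]
    ring
  · intro b _
    refine ((summable_powExp (k - 1) ?_).mul_left _).mul_left _
    have : (b / N : ℂ) = ((b / N : ℝ) : ℂ) := by push_cast; rfl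
    rwa [this, sub_im, ofReal_im, sub_zero]

theorem sum_charFourier_col {N : ℕ} [NeZero N] {k : ℕ} {χ : DirichletCharacter ℂ N}
    (hχ : χ (-1) = (-1) ^ k) {w : ℂ} (hw : 0 < w.im) :
    ∑ b ∈ range N, charFourier χ b * (symInvPow k ((b / N : ℝ) : ℂ) + lipschitzFactor k *
        (∑' d : ℕ+, powExpSeries k (d * w + (b / N : ℝ))
          + (-1) ^ k * ∑' d : ℕ+, powExpSeries k (d * w - (b / N : ℝ))))
      = ∑ b ∈ range N, charFourier χ b * symInvPow k ((b / N : ℝ) : ℂ)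
        + 2 * lipschitzFactor k * N * ∑' (d : ℕ+) (n : ℕ+), χ (n : ZMod N) *
          ((n : ℂ) ^ (k - 1) * cexp (2 * Real.pi * I * (d * w)) ^ (n : ℕ)) := by
  have him : ∀ d : ℕ+, 0 < (d * w).im := fun d => by
    have : (0 : ℝ) < d := by exact_mod_cast d.pos
    simpa using mul_pos this hw
  have h1 : ∑ b ∈ range N, charFourier χ b * ∑' d : ℕ+, powExpSeries k (d * w + (b / N : ℝ))
      = N * ∑' (d : ℕ+) (n : ℕ+), χ (n : ZMod N) *
          ((n : ℂ) ^ (k - 1) * cexp (2 * Real.pi * I * (d * w)) ^ (n : ℕ)) := by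
    simp only [← tsum_mul_left]
    rw [← Summable.tsum_finsetSum]
    · refine tsum_congr fun d => ?_
      rw [tsum_mul_left, ← sum_charFourier_powExpSeries χ k (him d)]
      simp
    · intro b _
      exact (summable_powExpSeries k hw (fun m => by simp [mul_comm])).mul_left _
  have h2 : ∑ b ∈ range N, charFourier χ b *
        ((-1) ^ k * ∑' d : ℕ+, powExpSeries k (d * w - (b / N : ℝ)))
      = N * ∑' (d : ℕ+) (n : ℕ+), χ (n : ZMod N) *
          ((n : ℂ) ^ (k - 1) * cexp (2 * Real.pi * I * (d * w)) ^ (n : ℕ)) := by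
    simp only [← tsum_mul_left]
    rw [← Summable.tsum_finsetSum]
    · refine tsum_congr fun d => ?_
      rw [tsum_mul_left, ← sum_charFourier_powExpSeries_sub hχ (him d)]
      simp
    · intro b _
      exact ((summable_powExpSeries k hw (fun m => by simp [mul_comm])).mul_left _).mul_left _
  have h3 : ∀ a b c d e : ℂ, a * (b + c * (d + e)) = a * b + c * (a * d + a * e) := by
    intros; ring
  simp only [h3, sum_add_distrib, ← mul_sum]
  rw [h1, h2]
  ring

/-! ### Bernoulli numbers and the constant terms -/

/-- Substitute `Nx` for the variable in the generating function of the Bernoulli polynomials at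
`a/N`. -/
theorem beta_eq_bernoulliFun {k : ℕ} (hk : 1 ≤ k) (N a : ℕ) [NeZero N] :
    beta k N a = (N : ℂ) ^ (k - 1) * (bernoulliFun k (a / N) : ℝ) := by
  have hN : (N : ℂ) ≠ 0 := Nat.cast_ne_zero.mpr (NeZero.ne N)
  have h1 := congr_arg (PowerSeries.rescale (N : ℂ))
    (Polynomial.bernoulli_generating_function (A := ℂ) (a / N : ℂ))
  rw [map_mul, map_mul, map_sub, map_one, PowerSeries.rescale_rescale, PowerSeries.rescale_X,
    div_mul_cancel₀ _ hN, mul_assoc, ← betaSeries_mul N a, ← mul_assoc] at h1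
  have h0 : PowerSeries.rescale (N : ℂ) (PowerSeries.exp ℂ) - 1 ≠ 0 := by
    intro h
    have := congr_arg (PowerSeries.coeff 1) h
    simp [PowerSeries.coeff_rescale, PowerSeries.coeff_exp, PowerSeries.coeff_one, hN] at this
  have h2 := congr_arg (PowerSeries.coeff k) (mul_right_cancel₀ h0 h1)
  rw [PowerSeries.coeff_rescale, PowerSeries.coeff_C_mul, PowerSeries.coeff_mk] at h2
  have h3 : ((bernoulliFun k (a / N) : ℝ) : ℂ)
      = Polynomial.aeval (a / N : ℂ) (Polynomial.bernoulli k) := by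
    have e : (a / N : ℂ) = algebraMap ℝ ℂ (a / N) := by simp
    rw [bernoulliFun, Polynomial.eval_map_algebraMap, e, Polynomial.aeval_algebraMap_apply]
    rfl
  have hf : (k.factorial : ℂ) ≠ 0 := Nat.cast_ne_zero.mpr k.factorial_ne_zero
  rw [map_smul, ← h3] at h2
  rw [beta]
  apply mul_left_cancel₀ hN
  rw [← mul_assoc (N : ℂ), ← mul_assoc (N : ℂ), ← pow_succ', Nat.sub_add_cancel hk,
    mul_right_comm, ← h2, Algebra.smul_def]
  simp
  field_simp

open ZMod in
theorem sum_Icc_cexp (N : ℕ) [NeZero N] (n : ℤ) :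
    ∑ a ∈ Icc 1 N, cexp (2 * Real.pi * I * n * ((a / N : ℝ) : ℂ))
      = if (n : ZMod N) = 0 then (N : ℂ) else 0 := by
  have h := AddChar.sum_mulShift (n : ZMod N) (isPrimitive_stdAddChar N)
  rw [ZMod.card] at h
  have h2 := sum_Icc_one_natCast (fun j : ZMod N => stdAddChar (j * (n : ZMod N)))
  rw [h] at h2
  push_cast at h2
  rw [← h2]
  refine sum_congr rfl fun a _ => ?_
  have := stdAddChar_coe (N := N) ((a : ℤ) * n)
  push_cast at this
  simp only [this]
  congr 1
  push_cast
  ring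

/-- The Fourier series of the Bernoulli function is evaluated at the points `a/N`, multiplied by
`e(ab/N)` and summed over `a`. Orthogonality keeps the frequencies `n ≡ -b` mod `N`, whose inverse
powers form the symmetric sum at `-b/N`. -/
theorem symInvPow_div {k : ℕ} (hk : 2 ≤ k) {N b : ℕ} [NeZero N] (hb : b < N) :
    symInvPow k ((b / N : ℝ) : ℂ) = -(lipschitzFactor k / k)
      * ∑ a ∈ Icc 1 N, beta k N a * cexp (2 * Real.pi * I * b * ((a / N : ℝ) : ℂ)) := by
  have hN : (N : ℂ) ≠ 0 := Nat.cast_ne_zero.mpr (NeZero.ne N)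
  have hNr : (0 : ℝ) < N := Nat.cast_pos.mpr (NeZero.pos N)
  have h1 : HasSum (fun n : ℤ => 1 / (n : ℂ) ^ k * if ((n + b : ℤ) : ZMod N) = 0 then (N : ℂ) else 0)
      (∑ a ∈ Icc 1 N, -(2 * Real.pi * I) ^ k / (k.factorial : ℂ) * (bernoulliFun k (a / N) : ℝ)
        * cexp (2 * Real.pi * I * b * ((a / N : ℝ) : ℂ))) := by
    have := hasSum_sum (s := Icc 1 N) (fun a ha =>
      (hasSum_one_div_pow_mul_fourier_mul_bernoulliFun hk (x := (a / N : ℝ)) (by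
        rw [mem_Icc] at ha
        refine ⟨by positivity, (div_le_one hNr).mpr (by exact_mod_cast ha.2)⟩)).mul_right
        (cexp (2 * Real.pi * I * b * ((a / N : ℝ) : ℂ))))
    refine this.congr_fun fun n => ?_
    rw [← sum_Icc_cexp, mul_sum]
    refine sum_congr rfl fun a _ => ?_
    rw [fourier_coe_apply, mul_assoc (1 / (n : ℂ) ^ k), ← Complex.exp_add]
    congr 2
    push_cast
    ring
  -- The surviving frequencies are exactly `n = Nj - b`.
  have hinj : Function.Injective (fun j : ℤ => (N : ℤ) * j - b) := fun i j h => by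
    simpa [NeZero.ne N] using h
  rw [← hinj.hasSum_iff] at h1
  · have hadm : ((b / N : ℝ) : ℂ) = 0 ∨ ((b / N : ℝ) : ℂ) ∈ integerComplement := by
      simpa using add_div_admissible (x := b / N) (by positivity)
        ((div_lt_one hNr).mpr (by exact_mod_cast hb)) (z := I) (by simp) 0
    have h2 := (hasSum_symInvPow_of_two_le hk (-((b / N : ℝ) : ℂ))).mul_left
      ((N : ℂ) / (N : ℂ) ^ k)
    rw [symInvPow_neg (by omega) hadm] at h2
    have h3 := h1.unique (h2.congr_fun fun j => by
      have e : -((b / N : ℝ) : ℂ) + j = (N * j - b) / N := by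
        push_cast
        field_simp
        ring
      simp only [Function.comp_apply]
      rw [if_pos (by simp), e, div_pow, inv_div]
      push_cast
      field_simp)
    have h4 : symInvPow k ((b / N : ℝ) : ℂ) = (-1) ^ k * ((N : ℂ) ^ (k - 1) *
        (N / (N : ℂ) ^ k * ((-1) ^ k * symInvPow k ((b / N : ℝ) : ℂ)))) := by
      have e1 : (N : ℂ) ^ (k - 1) * (N / (N : ℂ) ^ k) = 1 := by
        rw [← mul_div_assoc, ← pow_succ, Nat.sub_add_cancel (by omega), div_self (pow_ne_zero _ hN)]
      have e2 : ((-1 : ℂ) ^ k) * (-1) ^ k = 1 := by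
        rw [← mul_pow]; simp
      linear_combination (-(symInvPow k ((b / N : ℝ) : ℂ))) * e2
        - ((-1 : ℂ) ^ k) * ((-1) ^ k) * symInvPow k ((b / N : ℝ) : ℂ) * e1
    rw [h4, ← h3, mul_sum, mul_sum, mul_sum]
    refine sum_congr rfl fun a _ => ?_
    have hfac : (k.factorial : ℂ) = k * ((k - 1).factorial : ℂ) := by
      rw [← Nat.cast_mul, Nat.mul_factorial_pred (by omega)]
    have e : (-2 * Real.pi * I : ℂ) = -1 * (2 * Real.pi * I) := by ring
    rw [beta_eq_bernoulliFun (by omega), lipschitzFactor, hfac, e, mul_pow (-1 : ℂ)]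
    generalize (2 * Real.pi * I : ℂ) ^ k = A
    ring
  · intro n hn
    rw [if_neg, mul_zero]
    intro h
    rw [ZMod.intCast_zmod_eq_zero_iff_dvd] at h
    obtain ⟨j, hj⟩ := h
    exact hn ⟨j, by simp [← hj]⟩

theorem sum_Icc_mul_pow {N : ℕ} {w : ℂ} (hw : w ^ N = 1) (hw1 : w ≠ 1) :
    ∑ a ∈ Icc 1 N, (a : ℂ) * w ^ a = N * w / (w - 1) := by
  have h : ∀ n : ℕ, (w - 1) * ∑ a ∈ Icc 1 n, (a : ℂ) * w ^ a
      = n * w ^ (n + 1) - ∑ a ∈ Icc 1 n, w ^ a := by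
    intro n
    induction n with
    | zero => simp
    | succ n ih =>
      rw [sum_Icc_succ_top (by omega), sum_Icc_succ_top (by omega), mul_add, ih]
      push_cast
      ring
  have h2 : ∀ n : ℕ, (w - 1) * ∑ a ∈ Icc 1 n, w ^ a = w ^ (n + 1) - w := by
    intro n
    induction n with
    | zero => simp
    | succ n ih =>
      rw [sum_Icc_succ_top (by omega), mul_add, ih]
      ring
  have hw' : w - 1 ≠ 0 := sub_ne_zero.mpr hw1
  have h3 : ∑ a ∈ Icc 1 N, w ^ a = 0 := by
    have := h2 N
    rw [pow_succ, hw, one_mul, sub_self] at this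
    exact (mul_eq_zero.mp this).resolve_left hw'
  rw [eq_div_iff hw', mul_comm, h N, h3, pow_succ, hw]
  ring

/-- With `w = e(b/N)`, both sides equal `πi (w + 1)/(w - 1)`: the left by the cotangent formula, the
right because `β_{1,N,a} = a/N - 1/2` and `∑ wᵃ = 0` give `∑ β_{1,N,a} wᵃ = w/(w - 1)`. -/
theorem symInvPow_one_div {N b : ℕ} (hb0 : 0 < b) (hb : b < N) :
    symInvPow 1 ((b / N : ℝ) : ℂ) = 2 * Real.pi * I
      * ∑ a ∈ Icc 1 N, beta 1 N a * cexp (2 * Real.pi * I * b * ((a / N : ℝ) : ℂ))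
      - Real.pi * I := by
  have : NeZero N := ⟨by omega⟩
  have hNr : (0 : ℝ) < N := Nat.cast_pos.mpr (NeZero.pos N)
  have hN : (N : ℂ) ≠ 0 := Nat.cast_ne_zero.mpr (NeZero.ne N)
  have hbr : (0 : ℝ) < b := Nat.cast_pos.mpr hb0
  set w : ℂ := cexp (2 * Real.pi * I * ((b / N : ℝ) : ℂ)) with hw
  have hwN : w ^ N = 1 := by
    rw [hw, cexp_two_pi_I_mul_pow, Complex.exp_eq_one_iff]
    refine ⟨b, ?_⟩
    push_cast
    field_simp
  have hadm : ((b / N : ℝ) : ℂ) ∈ integerComplement := by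
    have := add_div_admissible (x := b / N) (by positivity)
        ((div_lt_one hNr).mpr (by exact_mod_cast hb)) (z := I) (by simp) 0
    rw [Int.cast_zero, zero_div, add_zero] at this
    refine this.resolve_left ?_
    exact_mod_cast (div_pos hbr hNr).ne'
  have hw1 : w ≠ 1 := by
    rw [hw, Ne, Complex.exp_eq_one_iff]
    rintro ⟨n, hn⟩
    refine hadm ⟨n, ?_⟩
    have h2 : (2 * Real.pi * I : ℂ) ≠ 0 := Complex.two_pi_I_ne_zero
    apply mul_left_cancel₀ h2
    rw [hn]
    ring
  have h1 : ∑ a ∈ Icc 1 N, beta 1 N a * cexp (2 * Real.pi * I * b * ((a / N : ℝ) : ℂ))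
      = w / (w - 1) := by
    have e : ∀ a ∈ Icc 1 N, beta 1 N a * cexp (2 * Real.pi * I * b * ((a / N : ℝ) : ℂ))
        = (N : ℂ)⁻¹ * (a * w ^ a) - 1 / 2 * cexp (2 * Real.pi * I * (b : ℤ) * ((a / N : ℝ) : ℂ)) := by
      intro a _
      rw [beta_eq_bernoulliFun le_rfl, bernoulliFun_one, hw, cexp_two_pi_I_mul_pow]
      have : (a : ℂ) * ((b / N : ℝ) : ℂ) = b * ((a / N : ℝ) : ℂ) := by
        push_cast
        ring
      rw [this]
      push_cast
      ring_nf
    rw [sum_congr rfl e, sum_sub_distrib, ← mul_sum, ← mul_sum, sum_Icc_cexp,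
      sum_Icc_mul_pow hwN hw1, if_neg]
    · field_simp
      ring
    · rw [ZMod.intCast_zmod_eq_zero_iff_dvd]
      intro h
      have := Nat.le_of_dvd hb0 (by exact_mod_cast h)
      omega
  rw [h1, symInvPow_one hadm, cot_pi_eq_exp_ratio, ← hw]
  have hw' : w - 1 ≠ 0 := sub_ne_zero.mpr hw1
  have hw'' : 1 - w ≠ 0 := sub_ne_zero.mpr hw1.symm
  have e : (w + 1) / (I * (1 - w)) = I * (w + 1) / (w - 1) := by
    rw [div_eq_div_iff (mul_ne_zero I_ne_zero hw'') hw']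
    linear_combination (w + 1) * (w - 1) * I_mul_I
  rw [e]
  field_simp
  ring

/-- The sum is `N χ(0)`, and `0` is a unit of `ZMod N` only for `N = 1`. -/
theorem sum_charFourier {N : ℕ} [NeZero N] (χ : DirichletCharacter ℂ N) :
    ∑ b ∈ range N, charFourier χ b = if N = 1 then 1 else 0 := by
  have h := sum_charFourier_mul χ 0
  simp only [Int.cast_zero, zero_mul, mul_zero, Complex.exp_zero, mul_one] at h
  rw [h]
  split_ifs with hN
  · subst hN
    have : (0 : ZMod 1) = 1 := Subsingleton.elim _ _
    simp [this]
  · rw [χ.map_zero' hN, mul_zero]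

theorem charFourier_zero_of_odd {N : ℕ} [NeZero N] {χ : DirichletCharacter ℂ N} {k : ℕ}
    (hχ : χ (-1) = (-1) ^ k) (hk : Odd k) : charFourier χ 0 = 0 := by
  have h := charFourier_mul_sub hχ (m := 0) (b := 0) le_rfl
  rw [hk.neg_one_pow] at h
  simp only [mul_zero, Nat.sub_zero] at h
  linear_combination h / 2

theorem charFourier_zero {N : ℕ} [NeZero N] (χ : DirichletCharacter ℂ N) :
    charFourier χ 0 = if χ.conductor = 1 then (N.totient : ℂ) else 0 := by
  rw [charFourier_eq_dft, Nat.cast_zero, ZMod.dft_apply_zero]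
  split_ifs with h <;> rw [← DirichletCharacter.eq_one_iff_conductor_eq_one] at h
  · rw [h, MulChar.sum_one_eq_card_units, ZMod.card_units_eq_totient]
  · exact MulChar.sum_eq_zero_of_ne_one h

theorem level_ne_one_of_odd {N : ℕ} {χ : DirichletCharacter ℂ N} {k : ℕ}
    (hχ : χ (-1) = (-1) ^ k) (hk : Odd k) : N ≠ 1 := by
  rintro rfl
  have : (-1 : ZMod 1) = 1 := Subsingleton.elim _ _
  rw [this, map_one, hk.neg_one_pow] at hχ
  norm_num at hχ

theorem conductor_ne_one_of_odd {N : ℕ} [NeZero N] {χ : DirichletCharacter ℂ N} {k : ℕ}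
    (hχ : χ (-1) = (-1) ^ k) (hk : Odd k) : χ.conductor ≠ 1 := by
  rw [Ne, ← DirichletCharacter.eq_one_iff_conductor_eq_one]
  rintro rfl
  rw [MulChar.one_apply isUnit_one.neg, hk.neg_one_pow] at hχ
  norm_num at hχ

theorem sum_charFourier_mul_sum_beta {N : ℕ} [NeZero N] (χ : DirichletCharacter ℂ N) (k : ℕ) :
    ∑ b ∈ range N, charFourier χ b *
        ∑ a ∈ Icc 1 N, beta k N a * cexp (2 * Real.pi * I * b * ((a / N : ℝ) : ℂ))
      = N * genBernoulli k χ := by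
  simp only [mul_sum, genBernoulli]
  rw [sum_comm]
  refine sum_congr rfl fun a _ => ?_
  have h := sum_charFourier_mul χ a
  push_cast at h
  rw [← mul_assoc, ← h, sum_mul]
  refine sum_congr rfl fun b _ => ?_
  push_cast
  ring_nf

theorem sum_charFourier_mul_symInvPow {N : ℕ} [NeZero N] {χ : DirichletCharacter ℂ N} {k : ℕ}
    (hk : 1 ≤ k) (hχ : χ (-1) = (-1) ^ k) :
    ∑ b ∈ range N, charFourier χ b * symInvPow k ((b / N : ℝ) : ℂ)
      = -(lipschitzFactor k / k) * (N * genBernoulli k χ) := by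
  rw [← sum_charFourier_mul_sum_beta]
  rcases hk.eq_or_lt with rfl | hk
  · have h0 := charFourier_zero_of_odd hχ odd_one
    have hN := level_ne_one_of_odd hχ odd_one
    have hs := sum_charFourier χ
    rw [if_neg hN] at hs
    -- The correction `-πi` is harmless: it may be included at `b = 0`, where `charFourier χ`
    -- vanishes, and its weighted sum over `b` is zero.
    have e : ∀ b ∈ range N, charFourier χ b * symInvPow 1 ((b / N : ℝ) : ℂ)
        = -(lipschitzFactor 1 / (1 : ℕ)) * (charFourier χ b *
          ∑ a ∈ Icc 1 N, beta 1 N a * cexp (2 * Real.pi * I * b * ((a / N : ℝ) : ℂ)))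
          - Real.pi * I * charFourier χ b := by
      intro b hb
      rcases Nat.eq_zero_or_pos b with rfl | hb0
      · simp [h0]
      · rw [symInvPow_one_div hb0 (mem_range.mp hb)]
        simp [lipschitzFactor]
        ring
    rw [sum_congr rfl e, sum_sub_distrib, ← mul_sum, ← mul_sum, hs, mul_zero, sub_zero]
  · rw [mul_sum]
    refine sum_congr rfl fun b hb => ?_
    rw [symInvPow_div hk (mem_range.mp hb)]
    ring

theorem symInvPow_zero {k : ℕ} (hk : 2 ≤ k) :
    symInvPow k 0 = -(lipschitzFactor k / k) * ((bernoulli k : ℚ) : ℂ) := by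
  have h := symInvPow_div hk (N := 1) (b := 0) one_pos
  rw [Icc_self, sum_singleton, beta_eq_bernoulliFun (by omega)] at h
  have hb : bernoulliFun k ((1 : ℕ) / (1 : ℕ)) = bernoulli k := by
    rw [Nat.cast_one, div_one, bernoulliFun_endpoints_eq_of_ne_one (by omega), bernoulliFun_eval_zero]
  rw [hb] at h
  simpa using h

/-- The second sum on the left is the defect from interchanging summations. For `k = 1` it alone
gives the constant term; for `k = 2` it is proportional to `∑ charFourier χ b`, hence vanishes
unless `N = 1`; for `k ≥ 3` it is zero. -/
theorem sum_residueConst {N : ℕ} [NeZero N] {χ : DirichletCharacter ℂ N} {k : ℕ}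
    (hk : 1 ≤ k) (hχ : χ (-1) = (-1) ^ k) {τ : ℂ} (hτ : τ ≠ 0) :
    ∑ b ∈ range N, residueConst k χ b
        + ∑ b ∈ range N, charFourier χ b * (subTwo k (b * τ) * (2 * Real.pi * I / (N * τ)))
      = 2 * lipschitzFactor k * hatConst k χ
        - (if N = 1 ∧ k = 2 then 2 * Real.pi * I / τ else 0) := by
  have hN : (N : ℂ) ≠ 0 := Nat.cast_ne_zero.mpr (NeZero.ne N)
  have hs := sum_charFourier χ
  rcases hk.eq_or_lt with rfl | hk
  · have h0 := charFourier_zero_of_odd hχ odd_one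
    rw [if_neg (level_ne_one_of_odd hχ odd_one)] at hs
    have e1 : ∀ b ∈ range N, residueConst 1 χ b = -(Real.pi * I) * charFourier χ b := by
      intro b _
      rw [residueConst, if_pos rfl]
      split_ifs with hb
      · simp [hb, h0]
      · rfl
    -- The defect is `bτ · 2πi/(Nτ) = 2πi b/N`, and `b/N = β_{1,N,b} + 1/2`.
    have e2 : ∀ b ∈ range N,
        charFourier χ b * (subTwo 1 (b * τ) * (2 * Real.pi * I / (N * τ)))
        = 2 * Real.pi * I * (charFourier χ b * beta 1 N b) + Real.pi * I * charFourier χ b := by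
      intro b _
      rw [beta_eq_bernoulliFun le_rfl, bernoulliFun_one]
      simp only [subTwo, if_true]
      push_cast
      field_simp
      ring
    -- The ranges differ only in `0` and `N`, where `charFourier χ` is zero by oddness and
    -- periodicity.
    have e3 : ∑ b ∈ Icc 1 N, charFourier χ b * beta 1 N b
        = ∑ b ∈ range N, charFourier χ b * beta 1 N b := by
      have hIcc : Icc 1 N = Ico 1 (N + 1) := by
        ext
        simp
      have h2 := sum_range_succ (fun b : ℕ => charFourier χ b * beta 1 N b) N
      rw [sum_range_succ'] at h2
      have hcN : charFourier χ N = 0 := by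
        have := charFourier_mul_add χ 1 0
        rwa [mul_one, add_zero, h0] at this
      rw [hcN, h0, zero_mul, zero_mul, add_zero, add_zero] at h2
      rw [hIcc, sum_Ico_eq_sum_range, ← h2]
      simp [add_comm]
    rw [sum_congr rfl e1, sum_congr rfl e2, sum_add_distrib, ← mul_sum, ← mul_sum, ← mul_sum, hs,
      hatConst, if_neg (conductor_ne_one_of_odd hχ odd_one), e3]
    simp [lipschitzFactor]
    ring
  · have hk1 : k ≠ 1 := by omega
    have e1 : ∑ b ∈ range N, residueConst k χ b = charFourier χ 0 * symInvPow k 0 := by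
      rw [sum_eq_single_of_mem 0 (mem_range.mpr (NeZero.pos N))]
      · simp [residueConst]
      · intro b _ hb
        simp [residueConst, hb, hk1]
    have e2 : ∑ b ∈ range N, charFourier χ b * (subTwo k (b * τ) * (2 * Real.pi * I / (N * τ)))
        = - (if N = 1 ∧ k = 2 then 2 * Real.pi * I / τ else 0) := by
      by_cases hk2 : k = 2
      · simp only [subTwo, hk2, OfNat.ofNat_ne_one, if_true, if_false, and_true, ← sum_mul]
        rw [hs]
        split_ifs with h1
        · simp [h1]
        · simp
      · simp [subTwo, hk1, hk2]
    rw [e1, e2, charFourier_zero, symInvPow_zero hk, hatConst, if_neg hk1]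
    ring

/-! ### Assembling the transformation formula -/

theorem tsum_tildeCoeff {N : ℕ} (χ : DirichletCharacter ℂ N) (k : ℕ) {z : ℂ} (hz : 0 < z.im) :
    ∑' (d : ℕ+) (n : ℕ+), χ (n : ZMod N) *
          ((n : ℂ) ^ (k - 1) * cexp (2 * Real.pi * I * (d * z)) ^ (n : ℕ))
      = ∑' m : ℕ+, tildeCoeff k χ m * cexp (2 * Real.pi * I * z) ^ (m : ℕ) :=
  tsum_lambert (k - 1) hz (fun _ n => χ (n : ZMod N)) (C := 1) fun _ _ => χ.norm_le_one _

theorem tsum_hatCoeff {N : ℕ} (χ : DirichletCharacter ℂ N) (k : ℕ) {z : ℂ} (hz : 0 < z.im) :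
    ∑' n : ℕ+, charFourier χ n * powExpSeries k (n * z)
      = ∑' m : ℕ+, hatCoeff k χ m * cexp (2 * Real.pi * I * z) ^ (m : ℕ) := by
  simp only [powExpSeries, ← tsum_mul_left]
  exact tsum_lambert (k - 1) hz (fun m _ => charFourier χ m) (C := N)
    fun m _ => norm_charFourier_le χ m

theorem sqrt_pow_mul_rpow (N k : ℕ) [NeZero N] :
    √(N : ℝ) ^ k * (N : ℝ) ^ ((k : ℝ) / 2 - 1) * N = (N : ℝ) ^ k := by
  have hN : (0 : ℝ) < N := Nat.cast_pos.mpr (NeZero.pos N)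
  rw [Real.sqrt_eq_rpow, ← Real.rpow_natCast, ← Real.rpow_mul hN.le, ← Real.rpow_add hN]
  nth_rewrite 2 [← Real.rpow_one (N : ℝ)]
  rw [← Real.rpow_add hN, ← Real.rpow_natCast]
  congr 1
  ring

/-- The transformation of `Ẽ_{k,χ}` under the Fricke involution. -/
theorem eisTilde_neg_one_div (N : ℕ) [NeZero N] (χ : DirichletCharacter ℂ N) (k : ℕ) (hk : 1 ≤ k)
    (hχ : χ (-1) = (-1) ^ k) (τ : ℂ) (hτ : 0 < τ.im) :
    eisTilde k χ (-1 / (N * τ))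
      = (((√(N : ℝ) : ℝ) : ℂ) * τ) ^ k * eisHat k χ τ
        + (if N = 1 ∧ k = 2 then I * N / (4 * Real.pi) * τ else 0) := by
  have hN : (N : ℂ) ≠ 0 := Nat.cast_ne_zero.mpr (NeZero.ne N)
  have hNr : (0 : ℝ) < N := Nat.cast_pos.mpr (NeZero.pos N)
  have hτ0 : τ ≠ 0 := by rintro rfl; simp at hτ
  have hk0 : (k : ℂ) ≠ 0 := Nat.cast_ne_zero.mpr (by omega)
  have hC : lipschitzFactor k ≠ 0 := by
    rw [lipschitzFactor]
    refine div_ne_zero (pow_ne_zero _ ?_) (Nat.cast_ne_zero.mpr (Nat.factorial_ne_zero _))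
    simp [Real.pi_ne_zero]
  have hz : 0 < (N * τ).im := by simpa using mul_pos hNr hτ
  have hw : 0 < (-1 / (N * τ)).im := im_neg_one_div_pos hz
  have hres : ∀ b ∈ range N,
      (N * τ) ^ k * (charFourier χ b * (symInvPow k (b * τ) + lipschitzFactor k *
        (∑' m : ℕ+, powExpSeries k ((N * m + b : ℕ) * τ)
          + (-1) ^ k * ∑' m : ℕ+, powExpSeries k ((N * m - b : ℕ) * τ))))
      = charFourier χ b * (symInvPow k ((b / N : ℝ) : ℂ) + lipschitzFactor k *
        (∑' d : ℕ+, powExpSeries k (d * (-1 / (N * τ)) + (b / N : ℝ))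
          + (-1) ^ k * ∑' d : ℕ+, powExpSeries k (d * (-1 / (N * τ)) - (b / N : ℝ))))
        - (N * τ) ^ k * (charFourier χ b *
          (subTwo k (b * τ) * (2 * Real.pi * I / (N * τ)))) := by
    intro b hb
    rw [mem_range] at hb
    -- With `x = b/N` and `z = Nτ`, the points `xz` and `mz ± xz` become `bτ` and `(Nm ± b)τ`.
    have h := inversion_residue hk (x := b / N) (by positivity)
      ((div_lt_one hNr).mpr (by exact_mod_cast hb)) hz
    have e0 : ((b / N : ℝ) : ℂ) * (N * τ) = b * τ := by
      push_cast
      field_simp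
    have e1 : ∀ m : ℕ+, (m : ℂ) * (N * τ) + b * τ = (N * m + b : ℕ) * τ := fun m => by
      push_cast
      ring
    have e2 : ∀ m : ℕ+, (m : ℂ) * (N * τ) - b * τ = (N * m - b : ℕ) * τ := fun m => by
      have : N ≤ N * m := Nat.le_mul_of_pos_right _ m.pos
      rw [Nat.cast_sub (by omega)]
      push_cast
      ring
    simp only [e0, e1, e2] at h
    linear_combination charFourier χ b * h
  have h := sum_congr rfl hres
  rw [sum_sub_distrib, ← mul_sum, ← mul_sum, sum_charFourier_row hk hχ hτ,
    sum_charFourier_col hχ hw, sum_charFourier_mul_symInvPow hk hχ, tsum_tildeCoeff χ k hw,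
    tsum_hatCoeff χ k hτ] at h
  have hconst := sum_residueConst hk hχ hτ0
  have hpow : (((√(N : ℝ) : ℝ) : ℂ) * τ) ^ k * (((N : ℝ) ^ ((k : ℝ) / 2 - 1) : ℝ) : ℂ) * N
      = (N * τ) ^ k := by
    rw [mul_pow, mul_pow, ← ofReal_natCast N, ← ofReal_pow, ← ofReal_pow, ← sqrt_pow_mul_rpow]
    push_cast
    ring
  -- For `N = 1`, `k = 2` the factor is `(-2πi)² = -4π²`, and both sides equal `-2πiτ`.
  have hextra : 2 * lipschitzFactor k * N *
      (if N = 1 ∧ k = 2 then I * N / (4 * Real.pi) * τ else 0)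
      = -((N * τ) ^ k * (if N = 1 ∧ k = 2 then 2 * Real.pi * I / τ else 0)) := by
    split_ifs with hc
    · obtain ⟨rfl, rfl⟩ := hc
      have hpi : (Real.pi : ℂ) ≠ 0 := ofReal_ne_zero.mpr Real.pi_ne_zero
      simp [lipschitzFactor]
      field_simp
      ring_nf
      simp [I_sq]
    · simp
  -- The summed identity is `2N · lipschitzFactor k` times the goal: the 2 from the two halves of
  -- each symmetric sum, the `N` from Fourier inversion.
  apply mul_left_cancel₀ (mul_ne_zero (mul_ne_zero two_ne_zero hC) hN)
  rw [mul_add _ (_ * _), hextra, eisTilde, eisHat]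
  have hB : 2 * lipschitzFactor k * N * (-genBernoulli k χ / (2 * k))
      = -(lipschitzFactor k / k) * (N * genBernoulli k χ) := by
    field_simp
  rw [mul_add, hB]
  linear_combination (-1 : ℂ) * h + (N * τ) ^ k * hconst
    - 2 * lipschitzFactor k * (hatConst k χ + ∑' m : ℕ+, hatCoeff k χ m
      * cexp (2 * Real.pi * I * τ) ^ (m : ℕ)) * hpow

end FrickeEisenstein

theorem mainTheorem3 (N : ℕ) [NeZero N] (χ : DirichletCharacter ℂ N) (k : ℕ) (hk : 1 ≤ k)
    (hχ : χ (-1) = (-1) ^ k) (τ : ℂ) (hτ : 0 < τ.im) :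
    FrickeEisenstein.eisTilde k χ (-1 / (N * τ))
      = (((√(N : ℝ) : ℝ) : ℂ) * τ) ^ k * FrickeEisenstein.eisHat k χ τ
        + (if N = 1 ∧ k = 2 then I * N / (4 * Real.pi) * τ else 0) :=
  FrickeEisenstein.eisTilde_neg_one_div N χ k hk hχ τ hτ
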